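/- Let $\mathbb{D}$ be the open unit disc and let $dA$ be the normalized area measure on $\mathbb{D}$. Let $B_1$ be the analytic Besov space (minimal Möbius invariant space) of all holomorphic functions $f$ on $\mathbb{D}$ with $$\|f\|_{B_1}=|f(0)|+|f'(0)|+\int_{\mathbb{D}}|f''(z)|\,dA(z)<\infty .$$ For $g$ holomorphic on $\mathbb{D}$ put $(I_gf)(z)=\int_0^z f'(w)g(w)\,dw$. If $I_g$ is a bounded operator on $B_1$, then its spectrum is $$\sigma(I_g)=\{0\}\cup\overline{g(\mathbb{D})}.$$ Moreover, for every $\lambda\in\mathbb{C}\setminus(\{0\}\cup\overline{g(\mathbb{D})})$ the operator $I-\frac1\lambda I_g$ has a bounded two-sided inverse $R_{\lambda,g}$ on $B_1$, given by $$R_{\lambda,g}h(z)=\int_0^z\frac{h'(\xi)}{1-\frac1\lambda g(\xi)}\,d\xi+h(0)=I_{(1-g/\lambda)^{-1}}h(z)+h(0),\qquad h\in B_1,\ z\in\mathbb{D}.$$ -/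

import Mathlib

open Set Metric MeasureTheory

noncomputable section

namespace MinimalMobius

/-- The underlying vector space of the analytic Besov space `B₁` of the unit disc: the functions
`f` that are holomorphic on the open unit disc and whose second derivative is integrable on the
disc with respect to area measure. A function on the disc is represented by its extension by zero
to `ℂ`, so that two elements are equal exactly when they agree on the disc. -/
def besovOneSubmodule : Submodule ℂ (ℂ → ℂ) where
  carrier := {f | DifferentiableOn ℂ f (ball 0 1) ∧ (∀ z ∉ ball (0 : ℂ) 1, f z = 0) ∧
    IntegrableOn (deriv (deriv f)) (ball 0 1) volume}
  zero_mem' := by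
    have h : deriv (0 : ℂ → ℂ) = 0 := by
      funext z
      exact deriv_const z 0
    refine ⟨differentiableOn_const 0, fun _ _ => rfl, ?_⟩
    rw [h, h]
    exact integrableOn_zero
  add_mem' := by
    rintro f g ⟨hf, hf0, hfi⟩ ⟨hg, hg0, hgi⟩
    refine ⟨hf.add hg, fun z hz => by simp [hf0 z hz, hg0 z hz], ?_⟩
    refine (hfi.add hgi).congr_fun (fun z hz => ?_) measurableSet_ball
    have h1 : EqOn (deriv (f + g)) (deriv f + deriv g) (ball 0 1) := fun w hw =>
      deriv_add (hf.differentiableAt (isOpen_ball.mem_nhds hw))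
        (hg.differentiableAt (isOpen_ball.mem_nhds hw))
    rw [h1.deriv isOpen_ball hz]
    exact (deriv_add ((hf.deriv isOpen_ball).differentiableAt (isOpen_ball.mem_nhds hz))
      ((hg.deriv isOpen_ball).differentiableAt (isOpen_ball.mem_nhds hz))).symm
  smul_mem' := by
    rintro c f ⟨hf, hf0, hfi⟩
    refine ⟨hf.const_smul c, fun z hz => by simp [hf0 z hz], ?_⟩
    have h2 : IntegrableOn (c • deriv (deriv f)) (ball 0 1) volume := hfi.smul c
    refine h2.congr_fun (fun z hz => ?_) measurableSet_ball
    have h1 : EqOn (deriv (c • f)) (c • deriv f) (ball 0 1) := fun w hw =>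
      deriv_const_smul c (hf.differentiableAt (isOpen_ball.mem_nhds hw))
    rw [h1.deriv isOpen_ball hz]
    exact (deriv_const_smul c
      ((hf.deriv isOpen_ball).differentiableAt (isOpen_ball.mem_nhds hz))).symm

/-- The analytic Besov space `B₁` of the unit disc (the minimal Möbius invariant space). It is a
separate type, so that its only topology is the one given by the norm below. -/
def BesovOne : Type := besovOneSubmodule

namespace BesovOne

instance : AddCommGroup BesovOne := inferInstanceAs (AddCommGroup besovOneSubmodule)

instance : Module ℂ BesovOne := inferInstanceAs (Module ℂ besovOneSubmodule)

instance : CoeFun BesovOne (fun _ => ℂ → ℂ) := ⟨fun f => f.1⟩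

/-- `‖f‖ = |f(0)| + |f'(0)| + ∫_𝔻 |f''| dA`, where `dA` is the area measure divided by `π`. -/
instance : Norm BesovOne :=
  ⟨fun f => ‖f 0‖ + ‖deriv f 0‖ + Real.pi⁻¹ * ∫ z in ball (0 : ℂ) 1, ‖deriv (deriv f) z‖⟩

theorem norm_def (f : BesovOne) : ‖f‖ =
    ‖f 0‖ + ‖deriv f 0‖ + Real.pi⁻¹ * ∫ z in ball (0 : ℂ) 1, ‖deriv (deriv f) z‖ := rfl

theorem differentiableOn (f : BesovOne) : DifferentiableOn ℂ f (ball 0 1) := f.2.1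

theorem eq_zero_of_notMem (f : BesovOne) {z : ℂ} (hz : z ∉ ball (0 : ℂ) 1) : f z = 0 :=
  f.2.2.1 z hz

theorem integrableOn (f : BesovOne) :
    IntegrableOn (deriv (deriv f)) (ball 0 1) volume := f.2.2.2

theorem ext_ball {f g : BesovOne} (h : ∀ z ∈ ball (0 : ℂ) 1, f z = g z) : f = g := by
  refine Subtype.ext (funext fun z => ?_)
  by_cases hz : z ∈ ball (0 : ℂ) 1
  · exact h z hz
  · exact (f.eq_zero_of_notMem hz).trans (g.eq_zero_of_notMem hz).symm

theorem deriv_add_eqOn (f g : BesovOne) :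
    EqOn (deriv (f + g : BesovOne)) (deriv f + deriv g) (ball 0 1) := fun _ hw =>
  deriv_add (f.differentiableOn.differentiableAt (isOpen_ball.mem_nhds hw))
    (g.differentiableOn.differentiableAt (isOpen_ball.mem_nhds hw))

theorem deriv_smul_eqOn (c : ℂ) (f : BesovOne) :
    EqOn (deriv (c • f : BesovOne)) (c • deriv f) (ball 0 1) := fun _ hw =>
  deriv_const_smul c (f.differentiableOn.differentiableAt (isOpen_ball.mem_nhds hw))

theorem deriv_deriv_add_eqOn (f g : BesovOne) :
    EqOn (deriv (deriv (f + g : BesovOne))) (deriv (deriv f) + deriv (deriv g)) (ball 0 1) := by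
  intro z hz
  rw [(deriv_add_eqOn f g).deriv isOpen_ball hz]
  exact deriv_add
    ((f.differentiableOn.deriv isOpen_ball).differentiableAt (isOpen_ball.mem_nhds hz))
    ((g.differentiableOn.deriv isOpen_ball).differentiableAt (isOpen_ball.mem_nhds hz))

theorem deriv_deriv_smul_eqOn (c : ℂ) (f : BesovOne) :
    EqOn (deriv (deriv (c • f : BesovOne))) (c • deriv (deriv f)) (ball 0 1) := by
  intro z hz
  rw [(deriv_smul_eqOn c f).deriv isOpen_ball hz]
  exact deriv_const_smul c
    ((f.differentiableOn.deriv isOpen_ball).differentiableAt (isOpen_ball.mem_nhds hz))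

theorem integral_nonneg' (f : BesovOne) :
    0 ≤ Real.pi⁻¹ * ∫ z in ball (0 : ℂ) 1, ‖deriv (deriv f) z‖ :=
  mul_nonneg (inv_nonneg.2 Real.pi_pos.le) (integral_nonneg fun _ => norm_nonneg _)

theorem eq_zero_of_norm_eq_zero (f : BesovOne) (h : ‖f‖ = 0) : f = 0 := by
  rw [norm_def] at h
  have hi := integral_nonneg' f
  have h0 : f 0 = 0 := norm_le_zero_iff.1 (by
    linarith [norm_nonneg (f 0), norm_nonneg (deriv f 0)])
  have h1 : deriv f 0 = 0 := norm_le_zero_iff.1 (by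
    linarith [norm_nonneg (f 0), norm_nonneg (deriv f 0)])
  have h2 : ∫ z in ball (0 : ℂ) 1, ‖deriv (deriv f) z‖ = 0 := by
    have : Real.pi⁻¹ * ∫ z in ball (0 : ℂ) 1, ‖deriv (deriv f) z‖ = 0 := by
      linarith [norm_nonneg (f 0), norm_nonneg (deriv f 0)]
    exact (mul_eq_zero.1 this).resolve_left (inv_ne_zero Real.pi_ne_zero)
  have hd1 : DifferentiableOn ℂ (deriv f) (ball 0 1) := f.differentiableOn.deriv isOpen_ball
  have hd2 : ContinuousOn (deriv (deriv f)) (ball 0 1) := (hd1.deriv isOpen_ball).continuousOn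
  have hae : deriv (deriv f) =ᵐ[volume.restrict (ball (0 : ℂ) 1)] fun _ => 0 := by
    have := (integral_eq_zero_iff_of_nonneg (fun _ => norm_nonneg _) f.integrableOn.norm).1 h2
    filter_upwards [this] with z hz
    simpa using hz
  have h3 : EqOn (deriv (deriv f)) (fun _ => 0) (ball 0 1) :=
    Measure.eqOn_open_of_ae_eq hae isOpen_ball hd2 continuousOn_const
  have hpre : IsPreconnected (ball (0 : ℂ) 1) := (convex_ball 0 1).isPreconnected
  have hmem : (0 : ℂ) ∈ ball (0 : ℂ) 1 := mem_ball_self one_pos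
  have h4 : EqOn (deriv f) 0 (ball 0 1) := fun z hz => by
    rw [isOpen_ball.is_const_of_deriv_eq_zero hpre hd1 h3 hz hmem, h1]
    rfl
  refine ext_ball fun z hz => ?_
  rw [isOpen_ball.is_const_of_deriv_eq_zero hpre f.differentiableOn h4 hz hmem, h0]
  rfl

theorem normedSpaceCore : NormedSpace.Core ℂ BesovOne where
  norm_nonneg f := by
    rw [norm_def]
    linarith [norm_nonneg (f 0), norm_nonneg (deriv f 0), integral_nonneg' f]
  norm_smul c f := by
    have hmem : (0 : ℂ) ∈ ball (0 : ℂ) 1 := mem_ball_self one_pos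
    have hi : ∫ z in ball (0 : ℂ) 1, ‖deriv (deriv (c • f : BesovOne)) z‖ =
        ‖c‖ * ∫ z in ball (0 : ℂ) 1, ‖deriv (deriv f) z‖ := by
      rw [← integral_const_mul]
      refine setIntegral_congr_fun measurableSet_ball fun z hz => ?_
      simp only [deriv_deriv_smul_eqOn c f hz, Pi.smul_apply, norm_smul]
    have h0 : (c • f : BesovOne) (0 : ℂ) = c • f 0 := rfl
    rw [norm_def, norm_def, hi, deriv_smul_eqOn c f hmem, h0, Pi.smul_apply, norm_smul, norm_smul]
    ring
  norm_triangle f g := by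
    have hmem : (0 : ℂ) ∈ ball (0 : ℂ) 1 := mem_ball_self one_pos
    have hi : ∫ z in ball (0 : ℂ) 1, ‖deriv (deriv (f + g : BesovOne)) z‖ ≤
        (∫ z in ball (0 : ℂ) 1, ‖deriv (deriv f) z‖) +
          ∫ z in ball (0 : ℂ) 1, ‖deriv (deriv g) z‖ := by
      rw [← integral_add f.integrableOn.norm g.integrableOn.norm]
      refine setIntegral_mono_on (f + g).integrableOn.norm
        (f.integrableOn.norm.add g.integrableOn.norm) measurableSet_ball fun z hz => ?_
      rw [deriv_deriv_add_eqOn f g hz]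
      exact norm_add_le _ _
    have hi' := mul_le_mul_of_nonneg_left hi (inv_nonneg.2 Real.pi_pos.le)
    rw [mul_add] at hi'
    have h0 : (f + g : BesovOne) (0 : ℂ) = f 0 + g 0 := rfl
    rw [norm_def, norm_def, norm_def, deriv_add_eqOn f g hmem, h0, Pi.add_apply]
    linarith [norm_add_le (f 0) (g 0), norm_add_le (deriv f 0) (deriv g 0)]
  norm_eq_zero_iff f := by
    refine ⟨eq_zero_of_norm_eq_zero f, ?_⟩
    rintro rfl
    have h : deriv ((0 : BesovOne) : ℂ → ℂ) = 0 := by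
      funext z
      exact deriv_const z 0
    have h' : deriv (0 : ℂ → ℂ) = 0 := by
      funext z
      exact deriv_const z 0
    have h0 : (0 : BesovOne) (0 : ℂ) = 0 := rfl
    rw [norm_def, h, h', h0]
    simp

instance : NormedAddCommGroup BesovOne := NormedAddCommGroup.ofCore normedSpaceCore

instance : NormedSpace ℂ BesovOne := NormedSpace.ofCore normedSpaceCore

end BesovOne

/-- `(I_g f)(z) = ∫₀ᶻ f'(w) g(w) dw`, the integral being taken along the segment from `0` to `z`,
parametrized by `w = t z` with `0 ≤ t ≤ 1`. -/
def volterraI (g f : ℂ → ℂ) (z : ℂ) : ℂ :=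
  ∫ t in (0 : ℝ)..1, deriv f (t * z) * g (t * z) * z

/-- `T` is the operator `I_g`, as a bounded linear operator on `B₁`. -/
def IsVolterraI (g : ℂ → ℂ) (T : BesovOne →L[ℂ] BesovOne) : Prop :=
  ∀ f : BesovOne, ∀ z ∈ ball (0 : ℂ) 1, T f z = volterraI g f z

end MinimalMobius

end

/-! On derivatives `I_g` is multiplication by `g`: `(I_g f)' = g f'`. Evaluation `f ↦ f'(a)` is a
bounded nonzero functional on `B₁` (`derivCLM`), hence an eigenvector of the adjoint of `I_g` with
eigenvalue `g(a)`. So `|g(a)| ≤ ‖I_g‖`, and any inverse of `μ - I_g` multiplies derivatives at `a`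
by `(μ - g(a))⁻¹`, which keeps `μ` at positive distance from `g(𝔻)`. The point `0` is spectral
because `I_g` is not surjective.

Conversely, for other `μ` the function `φ = (1 - g/μ)⁻¹` is bounded, and the candidate inverse
multiplies derivatives by `φ` and keeps the value at `0`. It is bounded on `B₁` because `(φ h')' = φ
h'' + φ' h'` with `φ' = φ² g'/μ`, while `h' g' = (I_g h)'' - g h''` is integrable with norm
controlled by `‖I_g‖ ‖h‖`. All bounds are explicit, so completeness of `B₁` plays no role. -/

namespace MinimalMobius

/-! ### Area sub-mean value inequality -/

/-- The sub-mean value property over discs for the modulus of a holomorphic function. -/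
theorem ofReal_mul_enorm_le_lintegral_ball {F : ℂ → ℂ} {c : ℂ} {R : ℝ} (hR : 0 < R)
    (hF : DifferentiableOn ℂ F (ball c R)) :
    ENNReal.ofReal (Real.pi * R ^ 2) * ‖F c‖ₑ ≤ ∫⁻ z in ball c R, ‖F z‖ₑ := by
  -- Extension by zero lets polar coordinates on the whole plane be used, without any integrability
  -- assumption.
  set φ : ℂ → ENNReal := (ball c R).indicator fun z => ‖F z‖ₑ with hφ
  have hφm : Measurable φ := by
    classical
    have h : Measurable ((ball c R).piecewise F 0) :=
      hF.continuousOn.measurable_piecewise continuousOn_const measurableSet_ball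
    have h' : φ = fun z => ‖(ball c R).piecewise F 0 z‖ₑ := by
      funext z
      by_cases hz : z ∈ ball c R <;> simp [hφ, hz]
    rw [h']
    exact h.enorm
  have hcirc : ∀ r ∈ Ioo 0 R, ENNReal.ofReal (2 * Real.pi) * ‖F c‖ₑ ≤
      ∫⁻ θ in Ioo (-Real.pi) Real.pi, φ (circleMap c r θ) := by
    rintro r ⟨hr0, hrR⟩
    have hsub : closedBall c |r| ⊆ ball c R := by
      rw [abs_of_pos hr0]
      exact closedBall_subset_ball hrR
    have hmv : Real.circleAverage F c r = F c :=
      (hF.mono hsub).diffContOnCl_ball Subset.rfl |>.circleAverage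
    have hint : ∫ θ in Ioo (-Real.pi) Real.pi, F (circleMap c r θ) = (2 * Real.pi : ℝ) • F c := by
      -- Circle averages use angles in `(0, 2π)`, polar coordinates use `(-π, π)`; periodicity
      -- reconciles them.
      have hper : Function.Periodic (fun θ => F (circleMap c r θ)) (2 * Real.pi) :=
        fun θ => congrArg F (periodic_circleMap c r θ)
      have := hper.intervalIntegral_add_eq (-Real.pi) 0
      rw [show -Real.pi + 2 * Real.pi = Real.pi by ring, zero_add] at this
      rw [← integral_Ioc_eq_integral_Ioo, ← intervalIntegral.integral_of_le (by
        linarith [Real.pi_pos]), this, ← hmv, Real.circleAverage_def, smul_smul,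
        mul_inv_cancel₀ Real.two_pi_pos.ne', one_smul]
    have hle := enorm_integral_le_lintegral_enorm (μ := volume.restrict (Ioo (-Real.pi) Real.pi))
      fun θ => F (circleMap c r θ)
    rw [hint, enorm_smul, Real.enorm_of_nonneg (by positivity)] at hle
    refine hle.trans (le_of_eq (lintegral_congr fun θ => ?_))
    have : circleMap c r θ ∈ ball c R := by
      rw [abs_of_pos hr0] at hsub
      exact hsub (circleMap_mem_closedBall c hr0.le θ)
    simp [hφ, this]
  have hrad : ∫⁻ r in Ioo 0 R, ENNReal.ofReal r = ENNReal.ofReal (R ^ 2 / 2) := by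
    rw [← ofReal_integral_eq_lintegral_ofReal, ← integral_Ioc_eq_integral_Ioo,
      ← intervalIntegral.integral_of_le hR.le, integral_id]
    · simp
    · exact (continuous_id.integrableOn_Icc (a := (0 : ℝ)) (b := R)).mono_set Ioo_subset_Icc_self
    · filter_upwards [ae_restrict_mem measurableSet_Ioo] with r hr using hr.1.le
  calc ENNReal.ofReal (Real.pi * R ^ 2) * ‖F c‖ₑ
      = ∫⁻ r in Ioo 0 R, ENNReal.ofReal r * (ENNReal.ofReal (2 * Real.pi) * ‖F c‖ₑ) := by
        rw [lintegral_mul_const _ (by fun_prop), hrad, ← mul_assoc,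
          ← ENNReal.ofReal_mul (by positivity)]
        congr 2
        ring
    _ ≤ ∫⁻ r in Ioo 0 R, ENNReal.ofReal r *
          ∫⁻ θ in Ioo (-Real.pi) Real.pi, φ (circleMap c r θ) :=
        setLIntegral_mono' measurableSet_Ioo fun r hr => by gcongr; exact hcirc r hr
    _ ≤ ∫⁻ r in Ioi 0, ENNReal.ofReal r *
          ∫⁻ θ in Ioo (-Real.pi) Real.pi, φ (circleMap c r θ) :=
        lintegral_mono_set Ioo_subset_Ioi_self
    _ = ∫⁻ p in Ioi (0 : ℝ) ×ˢ Ioo (-Real.pi) Real.pi,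
          ENNReal.ofReal p.1 * φ (circleMap c p.1 p.2) := by
        have hcm : Measurable fun p : ℝ × ℝ => circleMap c p.1 p.2 := by
          unfold circleMap
          fun_prop
        rw [Measure.volume_eq_prod, ← Measure.prod_restrict, lintegral_prod _ (by fun_prop)]
        refine lintegral_congr fun r => ?_
        exact (lintegral_const_mul _ (hφm.comp (by fun_prop))).symm
    _ = ∫⁻ z, φ (c + z) := by
        rw [← Complex.lintegral_comp_polarCoord_symm]
        refine lintegral_congr fun p => ?_
        rw [Complex.polarCoord_symm_apply, circleMap, Complex.exp_mul_I, smul_eq_mul,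
          Complex.ofReal_cos, Complex.ofReal_sin]
    _ = ∫⁻ z in ball c R, ‖F z‖ₑ := by
        rw [lintegral_add_left_eq_self, lintegral_indicator measurableSet_ball]

/-- The sub-mean value property over discs for the modulus of an integrable holomorphic
function. -/
theorem mul_norm_le_setIntegral_ball {F : ℂ → ℂ} {c : ℂ} {R : ℝ} (hR : 0 < R)
    (hF : DifferentiableOn ℂ F (ball c R)) (hFi : IntegrableOn F (ball c R)) :
    Real.pi * R ^ 2 * ‖F c‖ ≤ ∫ z in ball c R, ‖F z‖ := by
  have h := ofReal_mul_enorm_le_lintegral_ball hR hF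
  rw [← ofReal_integral_norm_eq_lintegral_enorm hFi, ← ofReal_norm,
    ← ENNReal.ofReal_mul (by positivity)] at h
  exact (ENNReal.ofReal_le_ofReal_iff (by positivity)).1 h

/-! ### Bounded evaluation of derivatives on `B₁` -/

namespace BesovOne

theorem differentiableOn_deriv (f : BesovOne) : DifferentiableOn ℂ (deriv f) (ball 0 1) :=
  f.differentiableOn.deriv isOpen_ball

theorem differentiableOn_deriv_deriv (f : BesovOne) :
    DifferentiableOn ℂ (deriv (deriv f)) (ball 0 1) :=
  f.differentiableOn_deriv.deriv isOpen_ball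

theorem norm_apply_zero_le (f : BesovOne) : ‖f 0‖ ≤ ‖f‖ := by
  rw [norm_def f]
  linarith [norm_nonneg (deriv f 0), integral_nonneg' f]

theorem norm_deriv_zero_le (f : BesovOne) : ‖deriv f 0‖ ≤ ‖f‖ := by
  rw [norm_def f]
  linarith [norm_nonneg (f 0), integral_nonneg' f]

theorem setIntegral_norm_le (f : BesovOne) :
    ∫ z in ball (0 : ℂ) 1, ‖deriv (deriv f) z‖ ≤ Real.pi * ‖f‖ := by
  rw [← inv_mul_le_iff₀ Real.pi_pos, norm_def f]
  linarith [norm_nonneg (f 0), norm_nonneg (deriv f 0)]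

/-- Sub-mean value inequality for `f''` on a disc inside `𝔻`; the `π` in its area cancels the
normalization of `dA`. -/
theorem norm_deriv_deriv_le (f : BesovOne) {z : ℂ} {r : ℝ} (hr : 0 < r) (hz : ‖z‖ + r ≤ 1) :
    ‖deriv (deriv f) z‖ ≤ (r ^ 2)⁻¹ * ‖f‖ := by
  have hsub : ball z r ⊆ ball 0 1 := ball_subset_ball' (by rw [dist_zero_right]; linarith)
  have h1 := mul_norm_le_setIntegral_ball hr (f.differentiableOn_deriv_deriv.mono hsub)
    (f.integrableOn.mono_set hsub)
  have h2 : ∫ w in ball z r, ‖deriv (deriv f) w‖ ≤ ∫ w in ball (0 : ℂ) 1, ‖deriv (deriv f) w‖ :=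
    setIntegral_mono_set f.integrableOn.norm (ae_of_all _ fun _ => norm_nonneg _)
      hsub.eventuallyLE
  have h3 := (h1.trans h2).trans f.setIntegral_norm_le
  rw [mul_assoc] at h3
  rw [le_inv_mul_iff₀ (by positivity)]
  exact le_of_mul_le_mul_left h3 Real.pi_pos

/-- Discs of radius `1 - ‖a‖` bound `f''` on the closed disc of radius `‖a‖`; the mean value
inequality then carries the bound on `f'` from `0` to `a`. -/
theorem norm_deriv_le (f : BesovOne) {a : ℂ} (ha : a ∈ ball (0 : ℂ) 1) :
    ‖deriv f a‖ ≤ (1 + ((1 - ‖a‖) ^ 2)⁻¹) * ‖f‖ := by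
  have ha' : ‖a‖ < 1 := by simpa using ha
  have hsub : closedBall (0 : ℂ) ‖a‖ ⊆ ball 0 1 := closedBall_subset_ball ha'
  have h := (convex_closedBall (0 : ℂ) ‖a‖).norm_image_sub_le_of_norm_deriv_le
    (f := deriv f) (x := 0) (y := a) (C := ((1 - ‖a‖) ^ 2)⁻¹ * ‖f‖)
    (fun z hz => f.differentiableOn_deriv.differentiableAt (isOpen_ball.mem_nhds (hsub hz)))
    (fun z hz => f.norm_deriv_deriv_le (by linarith)
      (by have := mem_closedBall_zero_iff.1 hz; linarith)) (by simp) (by simp)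
  have h0 : ((1 - ‖a‖) ^ 2)⁻¹ * ‖f‖ * ‖a - 0‖ ≤ ((1 - ‖a‖) ^ 2)⁻¹ * ‖f‖ := by
    rw [sub_zero]
    exact mul_le_of_le_one_right (by positivity) ha'.le
  have h1 := norm_le_norm_add_norm_sub (deriv f 0) (deriv f a)
  linarith [f.norm_deriv_zero_le, norm_sub_rev (deriv f 0) (deriv f a)]

/-- Evaluation of the derivative at a point of the disc, as a bounded functional on `B₁`. -/
noncomputable def derivCLM (a : ℂ) (ha : a ∈ ball (0 : ℂ) 1) : BesovOne →L[ℂ] ℂ :=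
  LinearMap.mkContinuous
    { toFun := fun f => deriv f a
      map_add' := fun f g => deriv_add_eqOn f g ha
      map_smul' := fun c f => deriv_smul_eqOn c f ha } _ fun f => f.norm_deriv_le ha

@[simp]
theorem derivCLM_apply (a : ℂ) (ha : a ∈ ball (0 : ℂ) 1) (f : BesovOne) :
    derivCLM a ha f = deriv f a := rfl

/-- The element of `B₁` given by a holomorphic function on the disc. -/
noncomputable def ofHolomorphic (F : ℂ → ℂ) (hF : DifferentiableOn ℂ F (ball 0 1))
    (hi : IntegrableOn (deriv (deriv F)) (ball 0 1) volume) : BesovOne :=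
  ⟨(ball 0 1).indicator F,
    hF.congr fun _ hz => indicator_of_mem hz F,
    fun _ hz => indicator_of_notMem hz F,
    hi.congr_fun (((eqOn_indicator (f := F)).deriv isOpen_ball).deriv isOpen_ball).symm
      measurableSet_ball⟩

theorem ofHolomorphic_eqOn (F : ℂ → ℂ) (hF : DifferentiableOn ℂ F (ball 0 1))
    (hi : IntegrableOn (deriv (deriv F)) (ball 0 1) volume) :
    EqOn (ofHolomorphic F hF hi) F (ball 0 1) := eqOn_indicator

theorem ext_deriv {f g : BesovOne} (h0 : f 0 = g 0)
    (h : ∀ z ∈ ball (0 : ℂ) 1, deriv f z = deriv g z) : f = g :=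
  ext_ball fun _ hz => isOpen_ball.eqOn_of_deriv_eq (convex_ball (0 : ℂ) 1).isPreconnected
    f.differentiableOn g.differentiableOn h (mem_ball_self one_pos) h0 hz

/-- A bounded operator acting on derivatives at a point as multiplication by `c` has norm at
least `‖c‖`. -/
theorem norm_le_of_deriv_eq_mul {S : BesovOne →L[ℂ] BesovOne} {a c : ℂ}
    (ha : a ∈ ball (0 : ℂ) 1) (hS : ∀ f : BesovOne, deriv (S f) a = c * deriv f a)
    {e : BesovOne} (he : deriv e a ≠ 0) : ‖c‖ ≤ ‖S‖ := by
  have hne : derivCLM a ha ≠ 0 := fun h => he (by rw [← derivCLM_apply a ha, h]; rfl)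
  -- The functional is an eigenvector of the adjoint of `S`; its nonzero norm cancels.
  have h : derivCLM a ha ∘L S = c • derivCLM a ha := ContinuousLinearMap.ext hS
  have h' := (derivCLM a ha).opNorm_comp_le S
  rw [h, norm_smul, mul_comm] at h'
  exact le_of_mul_le_mul_left h' (norm_pos_iff.2 hne)

end BesovOne

end MinimalMobius

/-! ### The operators `I_φ` and multiplication on derivatives -/

namespace MinimalMobius

@[simp]
theorem volterraI_zero (g f : ℂ → ℂ) : volterraI g f 0 = 0 := by
  simp [volterraI]

/-- The holomorphic function `f' g` has a primitive on the disc vanishing at `0`, and the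
fundamental theorem of calculus along the segment identifies it with the integral. -/
theorem hasDerivAt_volterraI {g f : ℂ → ℂ} (hg : DifferentiableOn ℂ g (ball 0 1))
    (hf : DifferentiableOn ℂ f (ball 0 1)) {z : ℂ} (hz : z ∈ ball (0 : ℂ) 1) :
    HasDerivAt (volterraI g f) (deriv f z * g z) z := by
  have hG : DifferentiableOn ℂ (fun w => deriv f w * g w) (ball 0 1) :=
    (hf.deriv isOpen_ball).mul hg
  obtain ⟨P, hP0, hP⟩ := hG.isExactOn_ball.with_val_at 0 0
  have heq : EqOn (volterraI g f) P (ball 0 1) := by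
    intro w hw
    have hmem : ∀ t ∈ uIcc (0 : ℝ) 1, (t : ℂ) * w ∈ ball (0 : ℂ) 1 := by
      intro t ht
      rw [uIcc_of_le zero_le_one] at ht
      rw [mem_ball_zero_iff] at hw ⊢
      rw [norm_mul, Complex.norm_real, Real.norm_of_nonneg ht.1]
      exact (mul_le_of_le_one_left (norm_nonneg w) ht.2).trans_lt hw
    have hd : ∀ t ∈ uIcc (0 : ℝ) 1, HasDerivAt (fun t : ℝ => P (t * w))
        (deriv f (t * w) * g (t * w) * w) t := by
      intro t ht
      have h1 : HasDerivAt (fun s : ℂ => s * w) w (t : ℂ) := by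
        simpa using (hasDerivAt_id (t : ℂ)).mul_const w
      exact ((hP _ (hmem t ht)).comp (t : ℂ) h1).comp_ofReal
    have hc : ContinuousOn (fun t : ℝ => deriv f (t * w) * g (t * w) * w) (uIcc 0 1) :=
      (hG.continuousOn.comp (f := fun t : ℝ => (t : ℂ) * w) (by fun_prop) hmem).mul
        continuousOn_const
    rw [volterraI, intervalIntegral.integral_eq_sub_of_hasDerivAt hd hc.intervalIntegrable]
    simp [hP0]
  exact (hP z hz).congr_of_eventuallyEq (heq.eventuallyEq_of_mem (isOpen_ball.mem_nhds hz))

namespace BesovOne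

/-- The constant function `1` on the disc. -/
noncomputable def one : BesovOne :=
  ofHolomorphic (fun _ => 1) (differentiableOn_const 1) (by simp)

/-- The identity function on the disc. -/
noncomputable def ident : BesovOne :=
  ofHolomorphic (fun z => z) differentiableOn_id (by simp)

theorem deriv_ident {z : ℂ} (hz : z ∈ ball (0 : ℂ) 1) : deriv ident z = 1 := by
  rw [ident, (ofHolomorphic_eqOn _ _ _).deriv isOpen_ball hz]
  simp

theorem deriv_sub {z : ℂ} (f g : BesovOne) (hz : z ∈ ball (0 : ℂ) 1) :
    deriv (f - g : BesovOne) z = deriv f z - deriv g z :=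
  (derivCLM z hz).map_sub f g

theorem deriv_smul {z : ℂ} (c : ℂ) (f : BesovOne) (hz : z ∈ ball (0 : ℂ) 1) :
    deriv (c • f : BesovOne) z = c * deriv f z :=
  deriv_smul_eqOn c f hz

end BesovOne

/-- If `φ` is bounded and `h ↦ h' φ'` is bounded from `B₁` to `L¹`, then `h ↦ I_φ h + h(0)` is a
bounded operator on `B₁`. -/
theorem exists_clm_volterraI_add {φ : ℂ → ℂ} {M K : ℝ} (hφ : DifferentiableOn ℂ φ (ball 0 1))
    (hM : ∀ z ∈ ball (0 : ℂ) 1, ‖φ z‖ ≤ M)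
    (hi : ∀ h : BesovOne, IntegrableOn (fun z => deriv h z * deriv φ z) (ball 0 1))
    (hK : ∀ h : BesovOne, ∫ z in ball (0 : ℂ) 1, ‖deriv h z * deriv φ z‖ ≤ K * ‖h‖) :
    ∃ R : BesovOne →L[ℂ] BesovOne, ∀ h : BesovOne, ∀ z ∈ ball (0 : ℂ) 1,
      R h z = volterraI φ h z + h 0 := by
  have hmem : (0 : ℂ) ∈ ball (0 : ℂ) 1 := mem_ball_self one_pos
  have hd (h : BesovOne) {z : ℂ} (hz : z ∈ ball (0 : ℂ) 1) :
      HasDerivAt (fun z => volterraI φ h z + h 0) (deriv h z * φ z) z :=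
    (hasDerivAt_volterraI hφ h.differentiableOn hz).add_const _
  have hdd (h : BesovOne) {z : ℂ} (hz : z ∈ ball (0 : ℂ) 1) :
      deriv (deriv fun z => volterraI φ h z + h 0) z =
        deriv (deriv h) z * φ z + deriv h z * deriv φ z := by
    have h1 : EqOn (deriv fun z => volterraI φ h z + h 0) (fun z => deriv h z * φ z) (ball 0 1) :=
      fun w hw => (hd h hw).deriv
    rw [h1.deriv isOpen_ball hz]
    exact deriv_fun_mul (h.differentiableOn_deriv.differentiableAt (isOpen_ball.mem_nhds hz))
      (hφ.differentiableAt (isOpen_ball.mem_nhds hz))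
  have hae : ∀ᵐ z ∂volume.restrict (ball (0 : ℂ) 1), ‖φ z‖ ≤ M := by
    filter_upwards [ae_restrict_mem measurableSet_ball] with z hz using hM z hz
  have hi' (h : BesovOne) : IntegrableOn (fun z => deriv (deriv h) z * φ z) (ball 0 1) :=
    h.integrableOn.mul_bdd (hφ.continuousOn.aestronglyMeasurable measurableSet_ball) hae
  let op (h : BesovOne) : BesovOne := BesovOne.ofHolomorphic (fun z => volterraI φ h z + h 0)
    (fun z hz => (hd h hz).differentiableAt.differentiableWithinAt)
    (((hi' h).add (hi h)).congr_fun (fun z hz => (hdd h hz).symm) measurableSet_ball)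
  have hop (h : BesovOne) : EqOn (op h) (fun z => volterraI φ h z + h 0) (ball 0 1) :=
    BesovOne.ofHolomorphic_eqOn _ _ _
  have hop0 (h : BesovOne) : op h 0 = h 0 := by simp [hop h hmem]
  have hopd (h : BesovOne) {z : ℂ} (hz : z ∈ ball (0 : ℂ) 1) :
      deriv (op h) z = deriv h z * φ z := by
    rw [(hop h).deriv isOpen_ball hz, (hd h hz).deriv]
  have hopdd (h : BesovOne) {z : ℂ} (hz : z ∈ ball (0 : ℂ) 1) :
      deriv (deriv (op h)) z = deriv (deriv h) z * φ z + deriv h z * deriv φ z := by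
    rw [((hop h).deriv isOpen_ball).deriv isOpen_ball hz, hdd h hz]
  let lin : BesovOne →ₗ[ℂ] BesovOne :=
    { toFun := op
      map_add' := fun f g => BesovOne.ext_deriv
        (by
          have h1 : (f + g : BesovOne) (0 : ℂ) = f 0 + g 0 := rfl
          have h2 : (op f + op g : BesovOne) (0 : ℂ) = op f 0 + op g 0 := rfl
          rw [h2, hop0, hop0, hop0, h1])
        fun z hz => by
          rw [BesovOne.deriv_add_eqOn _ _ hz, Pi.add_apply, hopd _ hz, hopd _ hz, hopd _ hz,
            BesovOne.deriv_add_eqOn _ _ hz, Pi.add_apply, add_mul]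
      map_smul' := fun c f => BesovOne.ext_deriv
        (by
          have h1 : (c • f : BesovOne) (0 : ℂ) = c * f 0 := rfl
          have h2 : (c • op f : BesovOne) (0 : ℂ) = c * op f 0 := rfl
          rw [RingHom.id_apply, h2, hop0, hop0, h1])
        fun z hz => by
          rw [RingHom.id_apply, BesovOne.deriv_smul _ _ hz, hopd _ hz, hopd _ hz,
            BesovOne.deriv_smul _ _ hz, mul_assoc] }
  -- The value at `0` contributes `1`, the derivative at `0` and the term `h'' φ` contribute `M`
  -- each, and `h' φ'` contributes `π⁻¹ K`.
  have hbound (h : BesovOne) : ‖lin h‖ ≤ (1 + 2 * M + Real.pi⁻¹ * K) * ‖h‖ := by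
    have hM0 : 0 ≤ M := (norm_nonneg _).trans (hM 0 hmem)
    have h1 : ∫ z in ball (0 : ℂ) 1, ‖deriv (deriv (op h)) z‖ ≤
        (∫ z in ball (0 : ℂ) 1, M * ‖deriv (deriv h) z‖) +
          ∫ z in ball (0 : ℂ) 1, ‖deriv h z * deriv φ z‖ := by
      rw [← integral_add (h.integrableOn.norm.const_mul M) (hi h).norm]
      refine setIntegral_mono_on (op h).integrableOn.norm
        ((h.integrableOn.norm.const_mul M).add (hi h).norm) measurableSet_ball fun z hz => ?_
      rw [hopdd h hz]
      refine (norm_add_le _ _).trans (add_le_add_left ?_ _)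
      rw [norm_mul, mul_comm]
      exact mul_le_mul_of_nonneg_right (hM z hz) (norm_nonneg _)
    rw [integral_const_mul] at h1
    have h2 : ∫ z in ball (0 : ℂ) 1, ‖deriv (deriv (op h)) z‖ ≤
        M * (Real.pi * ‖h‖) + K * ‖h‖ :=
      h1.trans (add_le_add (mul_le_mul_of_nonneg_left h.setIntegral_norm_le hM0) (hK h))
    have h3 := mul_le_mul_of_nonneg_left h2 (inv_nonneg.2 Real.pi_pos.le)
    have h4 : Real.pi⁻¹ * (M * (Real.pi * ‖h‖) + K * ‖h‖) =
        M * ‖h‖ + Real.pi⁻¹ * K * ‖h‖ := by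
      field_simp
    have h5 : ‖deriv (op h) 0‖ ≤ ‖h‖ * M := by
      rw [hopd h hmem, norm_mul]
      exact mul_le_mul h.norm_deriv_zero_le (hM 0 hmem) (norm_nonneg _) (norm_nonneg _)
    change ‖op h‖ ≤ _
    rw [BesovOne.norm_def, hop0]
    linarith [h.norm_apply_zero_le]
  exact ⟨lin.mkContinuous _ hbound, fun h z hz => hop h hz⟩

/-! ### The spectrum of `I_g` -/

namespace IsVolterraI

variable {g : ℂ → ℂ} {T : BesovOne →L[ℂ] BesovOne}

theorem apply_zero (hT : IsVolterraI g T) (f : BesovOne) : T f 0 = 0 := by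
  rw [hT f 0 (mem_ball_self one_pos), volterraI_zero]

theorem deriv_apply (hT : IsVolterraI g T) (hg : DifferentiableOn ℂ g (ball 0 1)) (f : BesovOne)
    {z : ℂ} (hz : z ∈ ball (0 : ℂ) 1) : deriv (T f) z = deriv f z * g z := by
  have h : EqOn (T f) (volterraI g f) (ball 0 1) := hT f
  rw [h.deriv isOpen_ball hz, (hasDerivAt_volterraI hg f.differentiableOn hz).deriv]

/-- The symbol of a bounded operator `I_g` is bounded by the norm of the operator. -/
theorem norm_symbol_le (hT : IsVolterraI g T) (hg : DifferentiableOn ℂ g (ball 0 1)) {z : ℂ}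
    (hz : z ∈ ball (0 : ℂ) 1) : ‖g z‖ ≤ ‖T‖ :=
  BesovOne.norm_le_of_deriv_eq_mul hz (fun f => by rw [hT.deriv_apply hg f hz, mul_comm])
    (e := BesovOne.ident) (by rw [BesovOne.deriv_ident hz]; exact one_ne_zero)

/-- The product rule for `(T h)' = h' g`, solved for the only term whose integrability is not
evident. -/
theorem deriv_mul_deriv_symbol (hT : IsVolterraI g T) (hg : DifferentiableOn ℂ g (ball 0 1))
    (h : BesovOne) {z : ℂ} (hz : z ∈ ball (0 : ℂ) 1) :
    deriv h z * deriv g z = deriv (deriv (T h)) z - deriv (deriv h) z * g z := by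
  have h1 : EqOn (deriv (T h)) (fun z => deriv h z * g z) (ball 0 1) :=
    fun w hw => hT.deriv_apply hg h hw
  rw [h1.deriv isOpen_ball hz,
    deriv_fun_mul (h.differentiableOn_deriv.differentiableAt (isOpen_ball.mem_nhds hz))
      (hg.differentiableAt (isOpen_ball.mem_nhds hz))]
  ring

theorem integrableOn_deriv_mul_deriv_symbol (hT : IsVolterraI g T)
    (hg : DifferentiableOn ℂ g (ball 0 1)) (h : BesovOne) :
    IntegrableOn (fun z => deriv h z * deriv g z) (ball 0 1) := by
  have hae : ∀ᵐ z ∂volume.restrict (ball (0 : ℂ) 1), ‖g z‖ ≤ ‖T‖ := by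
    filter_upwards [ae_restrict_mem measurableSet_ball] with z hz using hT.norm_symbol_le hg hz
  have h1 : IntegrableOn (fun z => deriv (deriv h) z * g z) (ball 0 1) :=
    h.integrableOn.mul_bdd (hg.continuousOn.aestronglyMeasurable measurableSet_ball) hae
  exact ((T h).integrableOn.sub h1).congr_fun
    (fun z hz => (hT.deriv_mul_deriv_symbol hg h hz).symm) measurableSet_ball

/-- The terms `(T h)''` and `h'' g` each cost `π ‖T‖ ‖h‖`. -/
theorem setIntegral_norm_deriv_mul_deriv_symbol_le (hT : IsVolterraI g T)
    (hg : DifferentiableOn ℂ g (ball 0 1)) (h : BesovOne) :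
    ∫ z in ball (0 : ℂ) 1, ‖deriv h z * deriv g z‖ ≤ 2 * Real.pi * ‖T‖ * ‖h‖ := by
  have h1 : ∫ z in ball (0 : ℂ) 1, ‖deriv h z * deriv g z‖ ≤
      (∫ z in ball (0 : ℂ) 1, ‖deriv (deriv (T h)) z‖) +
        ∫ z in ball (0 : ℂ) 1, ‖T‖ * ‖deriv (deriv h) z‖ := by
    rw [← integral_add (T h).integrableOn.norm (h.integrableOn.norm.const_mul _)]
    refine setIntegral_mono_on (hT.integrableOn_deriv_mul_deriv_symbol hg h).norm
      ((T h).integrableOn.norm.add (h.integrableOn.norm.const_mul _)) measurableSet_ball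
      fun z hz => ?_
    rw [hT.deriv_mul_deriv_symbol hg h hz]
    refine (norm_sub_le _ _).trans (add_le_add_right ?_ _)
    rw [norm_mul, mul_comm]
    exact mul_le_mul_of_nonneg_right (hT.norm_symbol_le hg hz) (norm_nonneg _)
  rw [integral_const_mul] at h1
  have h2 := (T h).setIntegral_norm_le.trans
    (mul_le_mul_of_nonneg_left (T.le_opNorm h) Real.pi_pos.le)
  have h3 := mul_le_mul_of_nonneg_left h.setIntegral_norm_le (norm_nonneg T)
  linarith

/-- `0` lies in the spectrum of `I_g`, because all functions in the range vanish at `0`. -/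
theorem zero_mem_spectrum (hT : IsVolterraI g T) : (0 : ℂ) ∈ spectrum ℂ T := by
  rw [spectrum.zero_mem_iff]
  rintro ⟨u, hu⟩
  have h1 : T ((u⁻¹ : (BesovOne →L[ℂ] BesovOne)ˣ).1 BesovOne.one) = BesovOne.one := by
    rw [← mul_apply_eq_comp, ← hu, Units.mul_inv, one_apply_eq_self]
  have h2 := hT.apply_zero ((u⁻¹ : (BesovOne →L[ℂ] BesovOne)ˣ).1 BesovOne.one)
  rw [h1, BesovOne.one, BesovOne.ofHolomorphic_eqOn _ _ _ (mem_ball_self one_pos)] at h2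
  exact one_ne_zero h2

/-- The closure of the range of `g` is contained in the spectrum of `I_g`. -/
theorem closure_image_subset_spectrum (hT : IsVolterraI g T)
    (hg : DifferentiableOn ℂ g (ball 0 1)) : closure (g '' ball 0 1) ⊆ spectrum ℂ T := by
  intro μ hμ
  rw [spectrum.mem_iff]
  rintro ⟨u, hu⟩
  set S : BesovOne →L[ℂ] BesovOne := (u⁻¹ : (BesovOne →L[ℂ] BesovOne)ˣ).1
  -- Differentiating `(μ - T) S f = f`; only this one-sided identity is needed.
  have hS (f : BesovOne) {z : ℂ} (hz : z ∈ ball (0 : ℂ) 1) :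
      deriv (S f) z * (μ - g z) = deriv f z := by
    have h1 : (algebraMap ℂ (BesovOne →L[ℂ] BesovOne) μ - T) (S f) = f := by
      rw [← mul_apply_eq_comp, ← hu, Units.mul_inv, one_apply_eq_self]
    have h2 : μ • S f - T (S f) = f := h1
    conv_rhs => rw [← h2]
    rw [BesovOne.deriv_sub _ _ hz, BesovOne.deriv_smul _ _ hz, hT.deriv_apply hg _ hz]
    ring
  -- This radius forces `‖(μ - g z)⁻¹‖ > ‖S‖ + 1`, against the bound by `‖S‖` below.
  obtain ⟨_, ⟨z, hz, rfl⟩, hzd⟩ := Metric.mem_closure_iff.1 hμ (‖S‖ + 1)⁻¹ (by positivity)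
  have hne : μ - g z ≠ 0 := fun h0 => by
    have := hS BesovOne.ident hz
    rw [h0, mul_zero, BesovOne.deriv_ident hz] at this
    exact zero_ne_one this
  have hle : ‖(μ - g z)⁻¹‖ ≤ ‖S‖ :=
    BesovOne.norm_le_of_deriv_eq_mul hz (fun f => by rw [← hS f hz]; field_simp)
      (e := BesovOne.ident) (by rw [BesovOne.deriv_ident hz]; exact one_ne_zero)
  rw [dist_eq_norm, lt_inv_comm₀ (norm_pos_iff.2 hne) (by positivity), ← norm_inv] at hzd
  linarith

/-- The inverse of `1 - μ⁻¹ I_g` for `μ` outside of `{0} ∪ closure (g(𝔻))`. -/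
theorem exists_inverse (hT : IsVolterraI g T) (hg : DifferentiableOn ℂ g (ball 0 1)) {μ : ℂ}
    (hμ : μ ∉ {0} ∪ closure (g '' ball 0 1)) :
    ∃ R : BesovOne →L[ℂ] BesovOne,
      (1 - μ⁻¹ • T) * R = 1 ∧ R * (1 - μ⁻¹ • T) = 1 ∧
      ∀ h : BesovOne, ∀ z ∈ ball (0 : ℂ) 1,
        R h z = volterraI (fun w => (1 - g w / μ)⁻¹) h z + h 0 := by
  rw [mem_union, not_or, mem_singleton_iff] at hμ
  obtain ⟨hμ0, hμc⟩ := hμ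
  have hmem : (0 : ℂ) ∈ ball (0 : ℂ) 1 := mem_ball_self one_pos
  obtain ⟨ε, hε, hεμ⟩ : ∃ ε > 0, ∀ z ∈ ball (0 : ℂ) 1, ε ≤ ‖μ - g z‖ := by
    rw [Metric.mem_closure_iff] at hμc
    push Not at hμc
    obtain ⟨ε, hε, h⟩ := hμc
    exact ⟨ε, hε, fun z hz => by simpa [dist_eq_norm] using h _ (mem_image_of_mem g hz)⟩
  have hne : ∀ z ∈ ball (0 : ℂ) 1, 1 - g z / μ ≠ 0 := fun z hz h0 => by
    have h1 : μ - g z = μ * (1 - g z / μ) := by field_simp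
    have h2 := hεμ z hz
    rw [h1, h0, mul_zero, norm_zero] at h2
    exact h2.not_gt hε
  set φ : ℂ → ℂ := fun w => (1 - g w / μ)⁻¹ with hφdef
  have hφ : DifferentiableOn ℂ φ (ball 0 1) := ((hg.div_const μ).const_sub 1).inv hne
  have hM : ∀ z ∈ ball (0 : ℂ) 1, ‖φ z‖ ≤ ‖μ‖ / ε := fun z hz => by
    have h1 : φ z = μ / (μ - g z) := by
      rw [hφdef]
      field_simp
    rw [h1, norm_div]
    exact div_le_div_of_nonneg_left (norm_nonneg _) hε (hεμ z hz)
  -- Since `φ' = φ² g'/μ`, the term `h' φ'` is a bounded multiple of `h' g'`, which boundedness of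
  -- `T` controls.
  have hφ' : ∀ h : BesovOne, ∀ z ∈ ball (0 : ℂ) 1,
      deriv h z * deriv φ z = deriv h z * deriv g z * (φ z ^ 2 / μ) := fun h z hz => by
    have h1 : HasDerivAt φ _ z := (((hg.differentiableAt (isOpen_ball.mem_nhds hz)).hasDerivAt
      |>.div_const μ).const_sub 1).inv (hne z hz)
    rw [h1.deriv]
    simp only [hφdef, inv_pow]
    ring
  have hψ : ∀ z ∈ ball (0 : ℂ) 1, ‖φ z ^ 2 / μ‖ ≤ (‖μ‖ / ε) ^ 2 / ‖μ‖ := fun z hz => by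
    rw [norm_div, norm_pow]
    gcongr
    exact hM z hz
  have hi : ∀ h : BesovOne, IntegrableOn (fun z => deriv h z * deriv φ z) (ball 0 1) := by
    intro h
    refine IntegrableOn.congr_fun ?_ (fun z hz => (hφ' h z hz).symm) measurableSet_ball
    refine (hT.integrableOn_deriv_mul_deriv_symbol hg h).mul_bdd (c := (‖μ‖ / ε) ^ 2 / ‖μ‖)
      (((hφ.pow 2).div_const μ).continuousOn.aestronglyMeasurable measurableSet_ball) ?_
    filter_upwards [ae_restrict_mem measurableSet_ball] with z hz using hψ z hz
  have hK : ∀ h : BesovOne, ∫ z in ball (0 : ℂ) 1, ‖deriv h z * deriv φ z‖ ≤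
      (‖μ‖ / ε) ^ 2 / ‖μ‖ * (2 * Real.pi * ‖T‖) * ‖h‖ := by
    intro h
    rw [mul_assoc]
    refine le_trans ?_ (mul_le_mul_of_nonneg_left
      (hT.setIntegral_norm_deriv_mul_deriv_symbol_le hg h) (by positivity))
    rw [← integral_const_mul]
    refine setIntegral_mono_on (hi h).norm
      ((hT.integrableOn_deriv_mul_deriv_symbol hg h).norm.const_mul _) measurableSet_ball
      fun z hz => ?_
    rw [hφ' h z hz, norm_mul, mul_comm]
    exact mul_le_mul_of_nonneg_right (hψ z hz) (norm_nonneg _)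
  obtain ⟨R, hR⟩ := exists_clm_volterraI_add hφ hM hi hK
  have hR0 (h : BesovOne) : R h 0 = h 0 := by rw [hR h 0 hmem, volterraI_zero, zero_add]
  have hRd (h : BesovOne) {z : ℂ} (hz : z ∈ ball (0 : ℂ) 1) :
      deriv (R h) z = deriv h z * φ z := by
    have h1 : EqOn (R h) (fun z => volterraI φ h z + h 0) (ball 0 1) := hR h
    rw [h1.deriv isOpen_ball hz,
      ((hasDerivAt_volterraI hφ h.differentiableOn hz).add_const _).deriv]
  have hA0 (h : BesovOne) : (h - μ⁻¹ • T h : BesovOne) (0 : ℂ) = h 0 := by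
    have h1 : (h - μ⁻¹ • T h : BesovOne) (0 : ℂ) = h 0 - μ⁻¹ * T h 0 := rfl
    rw [h1, hT.apply_zero, mul_zero, sub_zero]
  have hAd (h : BesovOne) {z : ℂ} (hz : z ∈ ball (0 : ℂ) 1) :
      deriv (h - μ⁻¹ • T h : BesovOne) z = deriv h z * (1 - g z / μ) := by
    rw [BesovOne.deriv_sub _ _ hz, BesovOne.deriv_smul _ _ hz, hT.deriv_apply hg _ hz]
    ring
  -- Both operators preserve the value at `0` and multiply derivatives by the reciprocal factors `φ`
  -- and `1 - g/μ`.
  refine ⟨R, ?_, ?_, hR⟩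
  · refine ContinuousLinearMap.ext fun h => ?_
    change R h - μ⁻¹ • T (R h) = h
    refine BesovOne.ext_deriv (by rw [hA0, hR0]) fun z hz => ?_
    rw [hAd _ hz, hRd _ hz, mul_assoc, inv_mul_cancel₀ (hne z hz), mul_one]
  · refine ContinuousLinearMap.ext fun h => ?_
    change R (h - μ⁻¹ • T h) = h
    refine BesovOne.ext_deriv (by rw [hR0, hA0]) fun z hz => ?_
    rw [hRd _ hz, hAd _ hz, mul_assoc, mul_inv_cancel₀ (hne z hz), mul_one]

theorem spectrum_eq (hT : IsVolterraI g T) (hg : DifferentiableOn ℂ g (ball 0 1)) :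
    spectrum ℂ T = {0} ∪ closure (g '' ball 0 1) := by
  refine Subset.antisymm (fun μ hμ => ?_) (union_subset
    (singleton_subset_iff.2 hT.zero_mem_spectrum) (hT.closure_image_subset_spectrum hg))
  by_contra hμ'
  have hμ0 : μ ≠ 0 := fun h => hμ' (Or.inl h)
  obtain ⟨R, hR1, hR2, -⟩ := hT.exists_inverse hg hμ'
  have hu : IsUnit (1 - μ⁻¹ • T) := ⟨⟨_, R, hR1, hR2⟩, rfl⟩
  refine spectrum.mem_iff.1 hμ ?_
  have h1 : algebraMap ℂ (BesovOne →L[ℂ] BesovOne) μ - T =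
      algebraMap ℂ (BesovOne →L[ℂ] BesovOne) μ * (1 - μ⁻¹ • T) := by
    rw [mul_sub, mul_one, ← Algebra.smul_def, smul_smul, mul_inv_cancel₀ hμ0, one_smul]
  rw [h1]
  exact ((IsUnit.mk0 μ hμ0).map (algebraMap ℂ (BesovOne →L[ℂ] BesovOne))).mul hu

end IsVolterraI

end MinimalMobius

theorem theorem14 (g : ℂ → ℂ) (hg : DifferentiableOn ℂ g (Metric.ball 0 1))
    (T : MinimalMobius.BesovOne →L[ℂ] MinimalMobius.BesovOne)
    (hT : MinimalMobius.IsVolterraI g T) :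
    spectrum ℂ T = {0} ∪ closure (g '' Metric.ball 0 1) ∧
    ∀ μ : ℂ, μ ∉ {0} ∪ closure (g '' Metric.ball 0 1) →
      ∃ R : MinimalMobius.BesovOne →L[ℂ] MinimalMobius.BesovOne,
        (1 - μ⁻¹ • T) * R = 1 ∧ R * (1 - μ⁻¹ • T) = 1 ∧
        ∀ h : MinimalMobius.BesovOne, ∀ z ∈ Metric.ball (0 : ℂ) 1,
          R h z = MinimalMobius.volterraI (fun w => (1 - g w / μ)⁻¹) h z + h 0 :=
  ⟨hT.spectrum_eq hg, fun _ hμ => hT.exists_inverse hg hμ⟩
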